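/- For finite sets $P$ of points and $\mathcal{L}$ of lines in the Euclidean plane, let $I(P,\mathcal{L})=\{(p,\ell)\in P\times\mathcal{L}: p\in\ell\}$ be the set of incidences, and let the incidence graph of $(P,\mathcal{L})$ be the bipartite graph with vertex parts $P$ and $\mathcal{L}$ and edge set $I(P,\mathcal{L})$. Say that $(P,\mathcal{L})$ contains a subconfiguration isomorphic to $(P_0,\mathcal{L}_0)$ if there are $P'\subseteq P$ and $\mathcal{L}'\subseteq\mathcal{L}$ such that the incidence graphs of $(P',\mathcal{L}')$ and $(P_0,\mathcal{L}_0)$ are isomorphic. Theorem. For every integer $t>1$ there is a constant $c=c(t)$, depending only on $t$, such that the following holds. Let $\mathcal{L}_1$ and $\mathcal{L}_2$ be two sets of $t$ lines in the plane such that the set $P_0=\{\ell_1\cap\ell_2:\ell_1\in\mathcal{L}_1,\ \ell_2\in\mathcal{L}_2\}$ of intersection points satisfies $|P_0|=t^2$. Let $P$ be a set of $m$ points and $\mathcal{L}$ a set of $n$ lines in the plane such that $(P,\mathcal{L})$ does not contain a subconfiguration isomorphic to $(P_0,\mathcal{L}_1\cup\mathcal{L}_2)$. Then $$|I(P,\mathcal{L})|\le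 c\left(m^{\frac{2t-2}{3t-2}}\,n^{\frac{2t-1}{3t-2}}+m^{1+\frac{1}{6t-3}}+n\right).$$ -/

import Mathlib

namespace PointLine

/-- The Euclidean plane. -/
abbrev Plane : Type := EuclideanSpace ℝ (Fin 2)

/-- Lines in the plane: the affine subspaces of dimension one (these are automatically nonempty,
since the empty affine subspace has direction `⊥`). -/
abbrev Line : Type :=
  {ℓ : AffineSubspace ℝ Plane // Module.finrank ℝ ℓ.direction = 1}

/-- `I(P, L)`: the set of incidences between the points of `P` and the lines of `L`. -/
def incidences (P : Set Plane) (L : Set Line) : Set (Plane × Line) :=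
  {x | x.1 ∈ P ∧ x.2 ∈ L ∧ x.1 ∈ x.2.1}

/-- The incidence graph of `(P, L)`: the bipartite graph with vertex parts `P` and `L` in which
a point and a line are adjacent exactly when they are incident. -/
def incidenceGraph (P : Set Plane) (L : Set Line) : SimpleGraph (P ⊕ L) where
  Adj
    | .inl p, .inr ℓ => (p.1, ℓ.1) ∈ incidences P L
    | .inr ℓ, .inl p => (p.1, ℓ.1) ∈ incidences P L
    | _, _ => False
  symm := ⟨by rintro (p | ℓ) (q | k) h <;> exact h⟩
  loopless := ⟨by rintro (p | ℓ) h <;> exact h⟩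

/-- Two configurations are isomorphic if their incidence graphs are isomorphic. -/
def Isomorphic (P : Set Plane) (L : Set Line) (P₀ : Set Plane) (L₀ : Set Line) : Prop :=
  Nonempty (incidenceGraph P L ≃g incidenceGraph P₀ L₀)

/-- `(P, L)` contains a subconfiguration isomorphic to `(P₀, L₀)`. -/
def ContainsCopy (P : Set Plane) (L : Set Line) (P₀ : Set Plane) (L₀ : Set Line) : Prop :=
  ∃ P' ⊆ P, ∃ L' ⊆ L, Isomorphic P' L' P₀ L₀

/-- `{ℓ₁ ∩ ℓ₂ : ℓ₁ ∈ L₁, ℓ₂ ∈ L₂}`: the points that are the intersection point of a line of `L₁`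
and a line of `L₂`. -/
def crossings (L₁ L₂ : Set Line) : Set Plane :=
  {p | ∃ ℓ₁ ∈ L₁, ∃ ℓ₂ ∈ L₂, (ℓ₁.1 : Set Plane) ∩ (ℓ₂.1 : Set Plane) = {p}}

end PointLine

namespace PointLine

open Finset

/-! ### The Kővári–Sós–Turán bound. -/

section Combinatorics

variable {α β : Type*}

/-! The forbidden configuration is a `t × t` grid, so the task is to bound incidences when `(P, L)`
has no grid (`GridFree`). Write `m` and `n` for the numbers of points and lines.

Weak bound. At each point, pair up the lines through it, and join two lines in an auxiliary graph
when they are paired somewhere. Two lines meet at most once, so an edge determines its point, and up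
to `m` the edges count half of the incidences. Because the pairing at each point is injective, a
`K_{t,t}` in this graph is a grid. Kővári–Sós–Turán gives `m + 4 t n ^ (2 - 1/t)`
(`sum_card_inc_le_of_no_grid`), and cutting the lines into groups of size `w` gives a bound linear
in `n` for fixed `w`.

Amplification by a cutting, in the dual plane. Dualize points to lines and sweep over the slope: at
a given slope the points are ranked by intercept, and any two exchange their order at most once.
Dividing the ranks into blocks of length `q`, and restarting a block after every `q` entries,
produces `O(1 + (m/q)^2)` cells that see at most `2q` points each (`exists_sweep_partition`). A line
with at most `q` points occupies consecutive ranks at its own slope, hence meets at most two cells.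
Richer lines carry at most `m^2/q` incidences and vertical ones at most `m`. The weak bound in every
cell, summed, is `GridFree.numInc_le_of_parameters`.

Taking `q ≈ m/r` and `w ≈ n/r^2`, with `r` balancing the two terms inside a cell, makes the total
`O(r m)`, which is the main term. The argument yields `m` in place of `m ^ (1 + 1/(6t-3))`, which is
stronger. -/

theorem natCast_le_rpow_two_sub_inv (n t : ℕ) (ht : 1 ≤ t) :
    (n : ℝ) ≤ (n : ℝ) ^ (2 - 1 / (t : ℝ)) := by
  rcases Nat.eq_zero_or_pos n with rfl | hn
  · simpa using Real.rpow_nonneg le_rfl _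
  have h1 : (1 : ℝ) ≤ n := by exact_mod_cast hn
  have ht' : (1 : ℝ) ≤ t := by exact_mod_cast ht
  have h2 : 1 / (t : ℝ) ≤ 1 := by
    rw [div_le_one (by linarith)]; exact ht'
  calc (n : ℝ) = (n : ℝ) ^ (1 : ℝ) := (Real.rpow_one _).symm
    _ ≤ _ := Real.rpow_le_rpow_of_exponent_le h1 (by linarith)

open Classical in
/-- Counting stars: if the bipartite graph `R` contains no `K_{t,t}`, then the number of pairs
consisting of a vertex and a `t`-set of neighbours is small. -/
theorem sum_choose_degree_le (R : α → β → Prop) (A : Finset α) (B : Finset β) (t : ℕ)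
    (h : ¬ ∃ (a : Fin t → α) (b : Fin t → β), Function.Injective a ∧ Function.Injective b ∧
      (∀ i, a i ∈ A) ∧ (∀ j, b j ∈ B) ∧ ∀ i j, R (a i) (b j)) :
    ∑ x ∈ A, (#{y ∈ B | R x y}).choose t ≤ t * (#B).choose t := by
  have key := sum_card_bipartiteAbove_eq_sum_card_bipartiteBelow
    (s := A) (t := B.powersetCard t) (fun x S => ∀ y ∈ S, R x y)
  have hl : ∀ x ∈ A, #((B.powersetCard t).bipartiteAbove (fun x S => ∀ y ∈ S, R x y) x) =
      (#{y ∈ B | R x y}).choose t := by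
    intro x _
    rw [← card_powersetCard]
    congr 1
    ext S
    simp only [bipartiteAbove, mem_filter, mem_powersetCard]
    constructor
    · rintro ⟨⟨h1, h2⟩, h3⟩
      exact ⟨fun y hy => mem_filter.2 ⟨h1 hy, h3 y hy⟩, h2⟩
    · rintro ⟨h1, h2⟩
      exact ⟨⟨fun y hy => (mem_filter.1 (h1 hy)).1, h2⟩, fun y hy => (mem_filter.1 (h1 hy)).2⟩
  rw [← sum_congr rfl hl, key]
  calc _ ≤ ∑ S ∈ B.powersetCard t, t := by
        refine sum_le_sum fun S hS => ?_
        by_contra! hlt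
        obtain ⟨hSB, hSt⟩ := mem_powersetCard.1 hS
        obtain ⟨A', hA', hcard⟩ := exists_subset_card_eq hlt.le
        refine h ⟨fun i => (A'.equivFinOfCardEq hcard).symm i,
          fun i => (S.equivFinOfCardEq hSt).symm i,
          Subtype.val_injective.comp (Equiv.injective _),
          Subtype.val_injective.comp (Equiv.injective _), fun i => ?_, fun j => ?_, fun i j => ?_⟩
        · exact (mem_filter.1 (hA' ((A'.equivFinOfCardEq hcard).symm i).2)).1
        · exact hSB ((S.equivFinOfCardEq hSt).symm j).2
        · exact (mem_filter.1 (hA' ((A'.equivFinOfCardEq hcard).symm i).2)).2 _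
            ((S.equivFinOfCardEq hSt).symm j).2
    _ = t * (#B).choose t := by simp [mul_comm]

open Classical in
/-- The Kővári–Sós–Turán theorem: a bipartite graph `R` without a `K_{t,t}` and with at most `n`
vertices on each side has at most `2 t n ^ (2 - 1 / t)` edges. -/
theorem sum_degree_le_of_no_biclique (R : α → β → Prop) (A : Finset α) (B : Finset β) (n t : ℕ)
    (ht : 1 ≤ t) (hA : #A ≤ n) (hB : #B ≤ n)
    (h : ¬ ∃ (a : Fin t → α) (b : Fin t → β), Function.Injective a ∧ Function.Injective b ∧
      (∀ i, a i ∈ A) ∧ (∀ j, b j ∈ B) ∧ ∀ i j, R (a i) (b j)) :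
    ∑ x ∈ A, (#{y ∈ B | R x y} : ℝ) ≤ 2 * t * (n : ℝ) ^ (2 - 1 / (t : ℝ)) := by
  have ht' : (1 : ℝ) ≤ t := by exact_mod_cast ht
  have hn := natCast_le_rpow_two_sub_inv n t ht
  -- Truncated excess degree: `(d + 1 - t) ^ t` is at most the falling factorial `d (d-1) ⋯
  -- (d-t+1)`, so star counting bounds a genuine power sum; the loss of at most `t` per vertex is
  -- restored at the end.
  set f : α → ℕ := fun x => #{y ∈ B | R x y} + 1 - t with hf
  have h1 : ∑ x ∈ A, f x ^ t ≤ t * n ^ t := by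
    calc ∑ x ∈ A, f x ^ t ≤ ∑ x ∈ A, (t.factorial * (#{y ∈ B | R x y}).choose t) := by
          refine sum_le_sum fun x _ => ?_
          rw [← Nat.descFactorial_eq_factorial_mul_choose]
          exact Nat.pow_sub_le_descFactorial _ _
      _ ≤ t.factorial * (t * (#B).choose t) := by
          rw [← mul_sum]
          exact Nat.mul_le_mul_left _ (sum_choose_degree_le R A B t h)
      _ = t * (#B).descFactorial t := by
          rw [Nat.descFactorial_eq_factorial_mul_choose]; ring
      _ ≤ t * n ^ t := Nat.mul_le_mul_left _
          ((Nat.descFactorial_le_pow _ _).trans (Nat.pow_le_pow_left hB _))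
  have h2 : (∑ x ∈ A, (f x : ℝ)) ^ t ≤ (t * (n : ℝ) ^ (2 - 1 / (t : ℝ))) ^ t := by
    obtain ⟨k, rfl⟩ : ∃ k, t = k + 1 := ⟨t - 1, by omega⟩
    rcases A.eq_empty_or_nonempty with rfl | hne
    · simp only [sum_empty]
      rw [zero_pow (by omega)]
      positivity
    have hc : (0 : ℝ) < #A := by exact_mod_cast hne.card_pos
    have h3 := pow_sum_div_card_le_sum_pow (s := A) (f := fun x => (f x : ℝ))
      (fun _ _ => Nat.cast_nonneg _) k
    rw [div_le_iff₀ (by positivity)] at h3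
    have h4 : (∑ x ∈ A, (f x : ℝ) ^ (k + 1)) ≤ (k + 1 : ℕ) * (n : ℝ) ^ (k + 1) := by
      exact_mod_cast h1
    have h5 : (#A : ℝ) ^ k ≤ (n : ℝ) ^ k := by gcongr
    -- Using `t ≤ t ^ t` lets the `t`-th root be taken with constant `t` rather than `t ^ (1/t)`.
    have hk1 : ((k + 1 : ℕ) : ℝ) ≤ ((k + 1 : ℕ) : ℝ) ^ (k + 1) := le_self_pow₀ ht' (by omega)
    have hexp : ((n : ℝ) ^ (2 - 1 / ((k + 1 : ℕ) : ℝ))) ^ (k + 1) = (n : ℝ) ^ (k + 1) * n ^ k := by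
      rw [← Real.rpow_natCast, ← Real.rpow_mul (Nat.cast_nonneg _), ← pow_add,
        ← Real.rpow_natCast]
      congr 1
      push_cast
      field_simp
      ring
    rw [mul_pow, hexp]
    calc _ ≤ (∑ x ∈ A, (f x : ℝ) ^ (k + 1)) * (#A : ℝ) ^ k := h3
      _ ≤ ((k + 1 : ℕ) * (n : ℝ) ^ (k + 1)) * (n : ℝ) ^ k := by gcongr
      _ = (k + 1 : ℕ) * ((n : ℝ) ^ (k + 1) * (n : ℝ) ^ k) := by ring
      _ ≤ _ := by gcongr
  have h6 : ∑ x ∈ A, (f x : ℝ) ≤ t * (n : ℝ) ^ (2 - 1 / (t : ℝ)) :=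
    le_of_pow_le_pow_left₀ (by omega) (by positivity) h2
  calc ∑ x ∈ A, (#{y ∈ B | R x y} : ℝ) ≤ ∑ x ∈ A, ((f x : ℝ) + t) := by
        refine sum_le_sum fun x _ => ?_
        have : #{y ∈ B | R x y} ≤ f x + t := by simp only [hf]; omega
        exact_mod_cast this
    _ = ∑ x ∈ A, (f x : ℝ) + #A * t := by rw [sum_add_distrib]; simp
    _ ≤ t * (n : ℝ) ^ (2 - 1 / (t : ℝ)) + (n : ℝ) ^ (2 - 1 / (t : ℝ)) * t := by
        have : (#A : ℝ) ≤ n := by exact_mod_cast hA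
        gcongr
        linarith
    _ = _ := by ring

/-! ### Grids, and the weak incidence bound from matchings. -/

/-- `a i`, `b j` and `p i j` form a grid: `p i j` lies on `a i` and on `b j` and on no other of
the lines. -/
structure IsGrid {t : ℕ} (Inc : α → β → Prop) (a b : Fin t → β) (p : Fin t → Fin t → α) :
    Prop where
  inc_left : ∀ i j k, Inc (p i j) (a k) ↔ k = i
  inc_right : ∀ i j k, Inc (p i j) (b k) ↔ k = j

/-- Every finite set can be perfectly matched within itself up to at most one element. -/
theorem exists_matching [DecidableEq β] (A : Finset β) :
    ∃ B ⊆ A, ∃ f : β → β, Set.InjOn f B ∧ (∀ x ∈ B, f x ∈ A ∧ f x ≠ x) ∧ #A ≤ 2 * #B + 1 := by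
  -- Two disjoint halves of size `#A / 2`, joined by a bijection; an odd element left over accounts
  -- for the `+ 1`.
  obtain ⟨B, hBA, hB⟩ := exists_subset_card_eq (s := A) (n := #A / 2) (by omega)
  obtain ⟨C, hCA, hC⟩ := exists_subset_card_eq (s := A \ B) (n := #A / 2)
    (by rw [card_sdiff_of_subset hBA]; omega)
  let e := equivOfCardEq (hB.trans hC.symm)
  refine ⟨B, hBA, fun x => if h : x ∈ B then e ⟨x, h⟩ else x, ?_, ?_, by omega⟩
  · intro x hx y hy hxy
    simp only [mem_coe] at hx hy
    simp only [hx, hy, dif_pos] at hxy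
    simpa using e.injective (Subtype.ext hxy)
  · intro x hx
    have h1 : (e ⟨x, hx⟩ : β) ∈ A \ B := hCA (e ⟨x, hx⟩).2
    simp only [hx, dif_pos]
    rw [mem_sdiff] at h1
    exact ⟨h1.1, fun h => h1.2 (by rw [h]; exact hx)⟩

open Classical in
/-- A point-line configuration without a `t × t` grid: the bound that uses only that two lines
share at most one point. -/
theorem sum_card_inc_le_of_no_grid (Inc : α → β → Prop)
    (hlin : ∀ p q a b, a ≠ b → Inc p a → Inc p b → Inc q a → Inc q b → p = q)
    (t : ℕ) (ht : 1 ≤ t) (P : Finset α) (L : Finset β)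
    (h : ¬ ∃ (a b : Fin t → β) (p : Fin t → Fin t → α), (∀ i, a i ∈ L) ∧ (∀ i, b i ∈ L) ∧
      (∀ i j, p i j ∈ P) ∧ IsGrid Inc a b p) :
    ∑ p ∈ P, (#{l ∈ L | Inc p l} : ℝ) ≤ #P + 4 * t * (#L : ℝ) ^ (2 - 1 / (t : ℝ)) := by
  choose B hB f hinj hf hcard using fun p => exists_matching {l ∈ L | Inc p l}
  -- Lines are joined when they are matched at some point of `P`; by `hlin` that point is unique, so
  -- edges count matched pairs.
  obtain ⟨R, hRdef⟩ : ∃ R : β → β → Prop, ∀ x y, R x y ↔ ∃ p ∈ P, x ∈ B p ∧ f p x = y :=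
    ⟨_, fun _ _ => Iff.rfl⟩
  have hBinc : ∀ p x, x ∈ B p → x ∈ L ∧ Inc p x := fun p x hx => mem_filter.1 (hB p hx)
  have hfinc : ∀ p x, x ∈ B p → f p x ∈ L ∧ Inc p (f p x) :=
    fun p x hx => mem_filter.1 (hf p x hx).1
  have huniq : ∀ p q x, x ∈ B p → x ∈ B q → f p x = f q x → p = q := by
    intro p q x hp hq hpq
    exact hlin p q x (f p x) (hf p x hp).2.symm (hBinc p x hp).2 (hfinc p x hp).2
      (hBinc q x hq).2 (hpq ▸ (hfinc q x hq).2)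
  have hR : ∑ x ∈ L, (#{y ∈ L | R x y} : ℝ) ≤ 2 * t * (#L : ℝ) ^ (2 - 1 / (t : ℝ)) := by
    refine sum_degree_le_of_no_biclique R L L #L t ht le_rfl le_rfl ?_
    rintro ⟨a, b, ha, hb, haL, hbL, hab⟩
    simp only [hRdef] at hab
    choose p hp hpB hpf using hab
    have hpa : ∀ i j, Inc (p i j) (a i) := fun i j => (hBinc _ _ (hpB i j)).2
    have hpb : ∀ i j, Inc (p i j) (b j) := fun i j => hpf i j ▸ (hfinc _ _ (hpB i j)).2
    have hne : ∀ i j, a i ≠ b j := fun i j => hpf i j ▸ (hf _ _ (hpB i j)).2.symm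
    refine h ⟨a, b, p, haL, hbL, hp, ⟨fun i j k => ⟨fun hk => ?_, fun hk => hk ▸ hpa i j⟩,
      fun i j k => ⟨fun hk => ?_, fun hk => hk ▸ hpb i j⟩⟩⟩
    -- If `p i j` also lies on `a k`, it equals `p k j`, both being on `a k` and `b j`. At that
    -- point `a i` and `a k` are then both matched to `b j`, against injectivity of the matching.
    -- The other family is similar: `a i` would have two partners.
    · have e := hlin _ _ _ _ (hne k j) (hpa k j) (hpb k j) hk (hpb i j)
      have h1 := hpf k j
      have h2 := hpB k j
      rw [e] at h1 h2
      exact ha (hinj _ h2 (hpB i j) (h1.trans (hpf i j).symm))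
    · have e := hlin _ _ _ _ (hne i k) (hpa i k) (hpb i k) (hpa i j) hk
      have h1 := hpf i k
      rw [e] at h1
      exact hb (h1.symm.trans (hpf i j))
  have hsum : ∑ p ∈ P, #(B p) ≤ ∑ x ∈ L, #{y ∈ L | R x y} := by
    rw [← card_sigma, ← card_sigma]
    refine card_le_card_of_injOn (fun z => ⟨z.2, f z.1 z.2⟩) ?_ ?_
    · rintro ⟨p, x⟩ hz
      simp only [mem_coe, mem_sigma] at hz
      simp only [mem_coe, mem_sigma, mem_filter, hRdef]
      exact ⟨(hBinc _ _ hz.2).1, (hfinc _ _ hz.2).1, p, hz.1, hz.2, rfl⟩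
    · rintro ⟨p, x⟩ hz ⟨q, y⟩ hw hzw
      simp only [mem_coe, mem_sigma] at hz hw
      simp only [Sigma.mk.injEq, heq_eq_eq] at hzw
      obtain ⟨rfl, h2⟩ := hzw
      rw [huniq p q x hz.2 hw.2 h2]
  have hsum' : ∑ p ∈ P, (#(B p) : ℝ) ≤ ∑ x ∈ L, (#{y ∈ L | R x y} : ℝ) := by exact_mod_cast hsum
  calc ∑ p ∈ P, (#{l ∈ L | Inc p l} : ℝ) ≤ ∑ p ∈ P, (2 * (#(B p) : ℝ) + 1) := by
        refine sum_le_sum fun p _ => ?_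
        exact_mod_cast hcard p
    _ = 2 * ∑ p ∈ P, (#(B p) : ℝ) + #P := by
        rw [sum_add_distrib, mul_sum]; simp
    _ ≤ _ := by linarith

open Classical in
/-- Splitting the lines into groups of size at most `w`. -/
theorem sum_card_inc_le_of_no_grid_of_split (Inc : α → β → Prop)
    (hlin : ∀ p q a b, a ≠ b → Inc p a → Inc p b → Inc q a → Inc q b → p = q)
    (t : ℕ) (ht : 1 ≤ t) (w : ℕ) (hw : 1 ≤ w) (P : Finset α) (L : Finset β)
    (h : ¬ ∃ (a b : Fin t → β) (p : Fin t → Fin t → α), (∀ i, a i ∈ L) ∧ (∀ i, b i ∈ L) ∧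
      (∀ i j, p i j ∈ P) ∧ IsGrid Inc a b p) :
    ∑ p ∈ P, (#{l ∈ L | Inc p l} : ℝ) ≤
      (#L / w + 1) * (#P + 4 * t * (w : ℝ) ^ (2 - 1 / (t : ℝ))) := by
  have hw' : (0 : ℝ) < w := by exact_mod_cast hw
  have ht' : (1 : ℝ) ≤ t := by exact_mod_cast ht
  have hexp : 0 ≤ 2 - 1 / (t : ℝ) := by
    have : 1 / (t : ℝ) ≤ 1 := by rw [div_le_one (by linarith)]; exact ht'
    linarith
  induction hn : #L using Nat.strong_induction_on generalizing L with
  | _ n ih =>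
    by_cases hle : n ≤ w
    · refine (sum_card_inc_le_of_no_grid Inc hlin t ht P L h).trans ?_
      have h1 : (#L : ℝ) ≤ w := by rw [hn]; exact_mod_cast hle
      have h2 : (#L : ℝ) ^ (2 - 1 / (t : ℝ)) ≤ (w : ℝ) ^ (2 - 1 / (t : ℝ)) := by gcongr
      have h3 : (0 : ℝ) ≤ #P + 4 * t * (w : ℝ) ^ (2 - 1 / (t : ℝ)) := by positivity
      have h4 : (0 : ℝ) ≤ n / w := by positivity
      have h5 : 4 * t * (#L : ℝ) ^ (2 - 1 / (t : ℝ)) ≤ 4 * t * (w : ℝ) ^ (2 - 1 / (t : ℝ)) := by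
        gcongr
      nlinarith
    · obtain ⟨W, hWL, hW⟩ := exists_subset_card_eq (s := L) (n := w) (by omega)
      have hcard : #(L \ W) = n - w := by rw [card_sdiff_of_subset hWL, hn, hW]
      have h1 := ih (n - w) (by omega) (L \ W) (fun ⟨a, b, p, ha, hb, hp, hg⟩ =>
        h ⟨a, b, p, fun i => (mem_sdiff.1 (ha i)).1, fun i => (mem_sdiff.1 (hb i)).1, hp, hg⟩) hcard
      have h2 := sum_card_inc_le_of_no_grid Inc hlin t ht P W (fun ⟨a, b, p, ha, hb, hp, hg⟩ =>
        h ⟨a, b, p, fun i => hWL (ha i), fun i => hWL (hb i), hp, hg⟩)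
      rw [hW] at h2
      have h3 : ∀ p, (#{l ∈ L | Inc p l} : ℝ) =
          #{l ∈ L \ W | Inc p l} + #{l ∈ W | Inc p l} := by
        intro p
        rw [← Nat.cast_add, ← card_union_of_disjoint
          (disjoint_filter_filter sdiff_disjoint), ← filter_union, sdiff_union_of_subset hWL]
      simp only [h3, sum_add_distrib]
      -- Peeling off one group of `w` lines lowers `n / w` by exactly one, which pays for that
      -- group.
      have h4 : ((n - w : ℕ) : ℝ) / w + 1 = n / w := by
        rw [Nat.cast_sub (by omega)]; field_simp; ring
      rw [h4] at h1
      linarith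

end Combinatorics

/-! ### A cutting by sweeping through changing rankings. -/

section Sweep

variable {α : Type*}

/-- An integer sequence that is monotone or antitone with values in `{0, 1}` has total variation
at most one. -/
theorem sum_abs_sub_le_one (g : ℕ → ℤ) (hg : Monotone g ∨ Antitone g) (h0 : ∀ k, 0 ≤ g k)
    (h1 : ∀ k, g k ≤ 1) (T : ℕ) : ∑ k ∈ range T, |g (k + 1) - g k| ≤ 1 := by
  rcases hg with hg | hg
  · rw [sum_congr rfl fun k _ => abs_of_nonneg (sub_nonneg.2 (hg k.le_succ)), sum_range_sub]
    linarith [h0 0, h1 T]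
  · have : ∀ k ∈ range T, |g (k + 1) - g k| = -(g (k + 1) - g k) :=
      fun k _ => abs_of_nonpos (sub_nonpos.2 (hg k.le_succ))
    rw [sum_congr rfl this, sum_neg_distrib, sum_range_sub]
    linarith [h0 T, h1 0]

/-- Hermite's identity: replacing `a` by `a + 1` shifts the summation window, and the new end term
exceeds the dropped one by 1. -/
theorem sum_range_add_div (a q : ℕ) (hq : 1 ≤ q) : ∑ s ∈ range q, (a + s) / q = a := by
  induction a with
  | zero =>
    refine sum_eq_zero fun s hs => ?_
    rw [zero_add]
    exact Nat.div_eq_of_lt (mem_range.1 hs)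
  | succ a ih =>
    have h1 := sum_range_succ (fun s => (a + s) / q) q
    have h2 := sum_range_succ' (fun s => (a + s) / q) q
    rw [h1, ih, Nat.add_div_right _ (by omega)] at h2
    have h3 : ∑ s ∈ range q, (a + 1 + s) / q = ∑ s ∈ range q, (a + (s + 1)) / q :=
      sum_congr rfl fun s _ => by congr 1; ring
    rw [h3]
    simp only [add_zero] at h2
    omega

/-- By monotonicity all differences have the same sign, so the absolute values come out. Thus a move
from rank `a` to rank `b` crosses `|a - b| / q` block boundaries on average over the offset. -/
theorem sum_range_abs_sub_div (a b q : ℕ) (hq : 1 ≤ q) :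
    ∑ s ∈ range q, |(((a + s) / q : ℕ) : ℤ) - (((b + s) / q : ℕ) : ℤ)| = |(a : ℤ) - b| := by
  wlog hab : b ≤ a generalizing a b
  · rw [abs_sub_comm (a : ℤ), ← this b a (by omega)]
    exact sum_congr rfl fun s _ => abs_sub_comm _ _
  have h : ∀ s ∈ range q, |(((a + s) / q : ℕ) : ℤ) - (((b + s) / q : ℕ) : ℤ)| =
      (((a + s) / q : ℕ) : ℤ) - (((b + s) / q : ℕ) : ℤ) := by
    intro s _
    refine abs_of_nonneg (sub_nonneg.2 ?_)
    exact_mod_cast Nat.div_le_div_right (by omega)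
  rw [sum_congr rfl h, sum_sub_distrib, abs_of_nonneg (by omega)]
  have h1 := sum_range_add_div a q hq
  have h2 := sum_range_add_div b q hq
  have h1' : ∑ s ∈ range q, (((a + s) / q : ℕ) : ℤ) = a := by exact_mod_cast h1
  have h2' : ∑ s ∈ range q, (((b + s) / q : ℕ) : ℤ) = b := by exact_mod_cast h2
  rw [h1', h2']

open Classical in
/-- The number of elements of `P` below `p` at time `τ`. -/
noncomputable def rank (P : Finset α) (below : ℕ → α → α → Prop) (τ : ℕ) (p : α) : ℕ :=
  #{q ∈ P | below τ q p}

/-- Each other element passes `p` at most once, so it adds at most one to the variation of the rank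
of `p`. -/
theorem sum_abs_rank_sub_le (P : Finset α) (below : ℕ → α → α → Prop)
    (hmono : ∀ p q, Monotone (fun τ => below τ p q) ∨ Antitone (fun τ => below τ p q))
    (T : ℕ) (p : α) :
    ∑ τ ∈ range T, |(rank P below (τ + 1) p : ℤ) - rank P below τ p| ≤ #P := by
  classical
  have hr : ∀ τ, (rank P below τ p : ℤ) = ∑ q ∈ P, if below τ q p then 1 else 0 := by
    intro τ
    rw [rank, card_filter]
    push_cast
    rfl
  calc _ ≤ ∑ τ ∈ range T, ∑ q ∈ P, |((if below (τ + 1) q p then 1 else 0 : ℤ) -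
          if below τ q p then 1 else 0)| := by
        refine sum_le_sum fun τ _ => ?_
        rw [hr, hr, ← sum_sub_distrib]
        exact abs_sum_le_sum_abs _ _
    _ = ∑ q ∈ P, ∑ τ ∈ range T, |((if below (τ + 1) q p then 1 else 0 : ℤ) -
          if below τ q p then 1 else 0)| := sum_comm
    _ ≤ ∑ q ∈ P, 1 := by
        refine sum_le_sum fun q _ => ?_
        refine sum_abs_sub_le_one (fun τ => if below τ q p then 1 else 0) ?_
          (fun k => by split_ifs <;> simp) (fun k => by split_ifs <;> simp) T
        refine (hmono q p).imp (fun h => ?_) (fun h => ?_)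
        · intro x y hxy
          have := h hxy
          by_cases hx : below x q p
          · have hy : below y q p := this hx
            simp [hx, hy]
          · simp only [hx, if_false]; split_ifs <;> simp
        · intro x y hxy
          have := h hxy
          by_cases hy : below y q p
          · have hx : below x q p := this hy
            simp [hx, hy]
          · simp only [hy, if_false]; split_ifs <;> simp
    _ = #P := by simp

open Classical in
/-- Some offset cuts the ranks into blocks of length `q` such that the total number of block
changes is at most `#P ^ 2 / q`. -/
theorem exists_offset (P : Finset α) (below : ℕ → α → α → Prop)
    (hmono : ∀ p q, Monotone (fun τ => below τ p q) ∨ Antitone (fun τ => below τ p q))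
    (T q : ℕ) (hq : 1 ≤ q) :
    ∃ s < q, q * ∑ τ ∈ range T, #{p ∈ P | (rank P below (τ + 1) p + s) / q ≠
      (rank P below τ p + s) / q} ≤ #P ^ 2 := by
  by_contra! hcon
  -- A change of block costs at least one in the difference of block indices; summing over all
  -- offsets then bounds the average.
  have hle : ∀ s ∈ range q, (∑ τ ∈ range T, #{p ∈ P | (rank P below (τ + 1) p + s) / q ≠
      (rank P below τ p + s) / q} : ℤ) ≤ ∑ p ∈ P, ∑ τ ∈ range T,
        |(((rank P below (τ + 1) p + s) / q : ℕ) : ℤ) - (((rank P below τ p + s) / q : ℕ) : ℤ)| := by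
    intro s _
    rw [sum_comm]
    refine sum_le_sum fun τ _ => ?_
    rw [card_filter]
    push_cast
    refine sum_le_sum fun p _ => ?_
    split_ifs with h
    · refine Int.one_le_abs (sub_ne_zero.2 fun h' => h ?_)
      exact_mod_cast h'
    · exact abs_nonneg _
  have htot : ∑ s ∈ range q, (∑ τ ∈ range T, #{p ∈ P | (rank P below (τ + 1) p + s) / q ≠
      (rank P below τ p + s) / q} : ℤ) ≤ #P ^ 2 := by
    calc _ ≤ _ := sum_le_sum hle
      _ = ∑ p ∈ P, ∑ τ ∈ range T, |(rank P below (τ + 1) p : ℤ) - rank P below τ p| := by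
        rw [sum_comm]
        refine sum_congr rfl fun p _ => ?_
        rw [sum_comm]
        exact sum_congr rfl fun τ _ => sum_range_abs_sub_div _ _ _ hq
      _ ≤ ∑ p ∈ P, (#P : ℤ) := sum_le_sum fun p _ => sum_abs_rank_sub_le P below hmono T p
      _ = #P ^ 2 := by simp [sq]
  have hlt : ∑ s ∈ range q, #P ^ 2 < ∑ s ∈ range q, q * ∑ τ ∈ range T,
      #{p ∈ P | (rank P below (τ + 1) p + s) / q ≠ (rank P below τ p + s) / q} :=
    sum_lt_sum_of_nonempty ⟨0, mem_range.2 hq⟩ fun s hs => hcon s (mem_range.1 hs)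
  rw [← mul_sum, sum_const, card_range, smul_eq_mul] at hlt
  have htot' : ∑ s ∈ range q, ∑ τ ∈ range T, #{p ∈ P | (rank P below (τ + 1) p + s) / q ≠
      (rank P below τ p + s) / q} ≤ #P ^ 2 := by exact_mod_cast htot
  exact absurd hlt (not_lt.2 (Nat.mul_le_mul_left _ htot'))

open Classical in
/-- The elements that enter the block `b` in the step after time `σ`. -/
noncomputable def entering (P : Finset α) (blk : ℕ → α → ℕ) (b σ : ℕ) : Finset α :=
  {p ∈ P | blk (σ + 1) p = b ∧ blk σ p ≠ b}

/-- The number of entries into the block `b` before time `τ`. -/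
noncomputable def entries (P : Finset α) (blk : ℕ → α → ℕ) (b τ : ℕ) : ℕ :=
  ∑ σ ∈ range τ, #(entering P blk b σ)

theorem entries_mono (P : Finset α) (blk : ℕ → α → ℕ) (b : ℕ) : Monotone (entries P blk b) :=
  fun _ _ h => sum_le_sum_of_subset (range_subset_range.2 h)

open Classical in
-- Between the first and last times at which the entry count has quotient `v`, fewer than `q`
-- entries occur. An element seen in that window was in the block at its start (at most `q` of
-- these) or entered during it.
theorem card_block_piece_le (P : Finset α) (blk : ℕ → α → ℕ) (q T b v : ℕ) (hq : 1 ≤ q)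
    (hblk : ∀ τ, #{p ∈ P | blk τ p = b} ≤ q) :
    #{p ∈ P | ∃ τ < T, blk τ p = b ∧ entries P blk b τ / q = v} ≤ 2 * q := by
  rcases ({τ ∈ range T | entries P blk b τ / q = v} : Finset ℕ).eq_empty_or_nonempty with he | hne
  · have : ({p ∈ P | ∃ τ < T, blk τ p = b ∧ entries P blk b τ / q = v} : Finset α) = ∅ := by
      refine filter_false_of_mem fun p _ => ?_
      rintro ⟨τ, hτ, _, hv⟩
      have : τ ∈ ({τ ∈ range T | entries P blk b τ / q = v} : Finset ℕ) :=
        mem_filter.2 ⟨mem_range.2 hτ, hv⟩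
      simp [he] at this
    simp [this]
  set S : Finset ℕ := {τ ∈ range T | entries P blk b τ / q = v} with hS
  set τ₀ := S.min' hne with h0
  set τ₁ := S.max' hne with h1
  have hv0 : entries P blk b τ₀ / q = v := (mem_filter.1 (S.min'_mem hne)).2
  have hv1 : entries P blk b τ₁ / q = v := (mem_filter.1 (S.max'_mem hne)).2
  have h01 : τ₀ ≤ τ₁ := S.min'_le _ (S.max'_mem hne)
  have hsub : ({p ∈ P | ∃ τ < T, blk τ p = b ∧ entries P blk b τ / q = v} : Finset α) ⊆
      {p ∈ P | blk τ₀ p = b} ∪ (Ico τ₀ τ₁).biUnion (entering P blk b) := by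
    intro p hp
    obtain ⟨hpP, τ, hτ, hb, hv⟩ := mem_filter.1 hp
    have hτS : τ ∈ S := mem_filter.2 ⟨mem_range.2 hτ, hv⟩
    have hτ0 : τ₀ ≤ τ := S.min'_le _ hτS
    have hτ1 : τ ≤ τ₁ := S.le_max' _ hτS
    rw [mem_union, mem_biUnion]
    by_contra! hcon
    obtain ⟨hc1, hc2⟩ := hcon
    have hstay : ∀ σ, τ₀ ≤ σ → σ ≤ τ₁ → blk σ p ≠ b := by
      intro σ hσ
      induction σ, hσ using Nat.le_induction with
      | base => exact fun _ h => hc1 (mem_filter.2 ⟨hpP, h⟩)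
      | succ σ hσ ih =>
        intro hσ1 h
        exact hc2 σ (mem_Ico.2 ⟨hσ, hσ1⟩) (mem_filter.2 ⟨hpP, h, ih (by omega)⟩)
    exact hstay τ hτ0 hτ1 hb
  have hsum : entries P blk b τ₀ + ∑ σ ∈ Ico τ₀ τ₁, #(entering P blk b σ) = entries P blk b τ₁ :=
    sum_range_add_sum_Ico _ h01
  have hlt : entries P blk b τ₁ < entries P blk b τ₀ + q := by
    have e0 := Nat.div_add_mod (entries P blk b τ₀) q
    have e1 := Nat.div_add_mod (entries P blk b τ₁) q
    have l1 := Nat.mod_lt (entries P blk b τ₁) hq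
    rw [hv0] at e0
    rw [hv1] at e1
    omega
  have hc := (card_le_card hsub).trans (card_union_le _ _)
  have hc2 : #((Ico τ₀ τ₁).biUnion (entering P blk b)) ≤
    ∑ σ ∈ Ico τ₀ τ₁, #(entering P blk b σ) := card_biUnion_le
  have := hblk τ₀
  omega

open Classical in
-- An element entering a block changes block, and it enters only one block per step.
theorem sum_entries_le (P : Finset α) (blk : ℕ → α → ℕ) (T M : ℕ) :
    ∑ b ∈ range M, entries P blk b T ≤ ∑ τ ∈ range T, #{p ∈ P | blk (τ + 1) p ≠ blk τ p} := by
  simp only [entries]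
  rw [sum_comm]
  refine sum_le_sum fun τ _ => ?_
  rw [← card_biUnion]
  · refine card_le_card fun p hp => ?_
    obtain ⟨b, -, hp⟩ := mem_biUnion.1 hp
    obtain ⟨hpP, h1, h2⟩ := mem_filter.1 hp
    exact mem_filter.2 ⟨hpP, fun h => h2 (h ▸ h1)⟩
  · intro b _ c _ hbc
    refine disjoint_left.2 fun p hp hp' => hbc ?_
    exact (mem_filter.1 hp).2.1.symm.trans (mem_filter.1 hp').2.1

open Classical in
/-- A cutting in dual form: sweeping over `T` times, the pairs (time, element) can be divided into
`O((m / q) ^ 2)` classes each of which sees at most `2 q` of the `m` elements; at each time the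
classes consist of blocks of consecutive elements. -/
theorem exists_sweep_partition (P : Finset α) (below : ℕ → α → α → Prop)
    (hmono : ∀ p q, Monotone (fun τ => below τ p q) ∨ Antitone (fun τ => below τ p q))
    (hinj : ∀ τ, Set.InjOn (rank P below τ) P) (T q : ℕ) (hq : 1 ≤ q) :
    ∃ (s : ℕ) (g : ℕ → ℕ → ℕ) (K : Finset (ℕ × ℕ)),
      (∀ τ < T, ∀ p ∈ P, ((rank P below τ p + s) / q, g ((rank P below τ p + s) / q) τ) ∈ K) ∧
      (∀ κ : ℕ × ℕ, #{p ∈ P | ∃ τ < T,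
        ((rank P below τ p + s) / q, g ((rank P below τ p + s) / q) τ) = κ} ≤ 2 * q) ∧
      (#K : ℝ) ≤ #P / q + 2 + #P ^ 2 / q ^ 2 := by
  obtain ⟨s, hsq, hs⟩ := exists_offset P below hmono T q hq
  set blk : ℕ → α → ℕ := fun τ p => (rank P below τ p + s) / q with hblk
  have hq' : (0 : ℝ) < q := by exact_mod_cast hq
  -- A cell is a block together with the number of completed batches of `q` entries into it. Since
  -- `s < q`, block indices are at most `#P / q + 1`.
  refine ⟨s, fun b τ => entries P blk b τ / q,
    (range (#P / q + 2)).biUnion fun b => (range (entries P blk b T / q + 1)).image (Prod.mk b),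
    fun τ hτ p hp => ?_, ?_, ?_⟩
  · simp only [mem_biUnion, mem_image, mem_range, Prod.mk.injEq]
    refine ⟨_, ?_, _, Nat.lt_succ_of_le (Nat.div_le_div_right (entries_mono P blk _ hτ.le)), rfl, rfl⟩
    have h1 : rank P below τ p ≤ #P := card_filter_le _ _
    calc (rank P below τ p + s) / q ≤ (#P + q) / q := Nat.div_le_div_right (by omega)
      _ = #P / q + 1 := Nat.add_div_right _ (by omega)
      _ < _ := by omega
  · rintro ⟨b, v⟩
    have := card_block_piece_le P blk q T b v hq (fun τ => ?_)
    · convert this using 4 with p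
      funext τ
      refine propext (and_congr_right fun _ => ?_)
      simp only [Prod.mk.injEq]
      constructor
      · rintro ⟨h1, h2⟩
        exact ⟨h1, h1 ▸ h2⟩
      · rintro ⟨h1, h2⟩
        exact ⟨h1, by rw [← h2, ← h1]⟩
    -- Ranks are distinct, so the shifted ranks inject a block into an interval of length `q`.
    · have : #{p ∈ P | blk τ p = b} ≤ #(Ico (b * q) (b * q + q)) := by
        refine card_le_card_of_injOn (fun p => rank P below τ p + s) (fun p hp => ?_)
          (fun p hp p' hp' h => ?_)
        · have h := (mem_filter.1 (mem_coe.1 hp)).2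
          simp only [hblk] at h
          rw [mem_coe, mem_Ico]
          beta_reduce
          have e := Nat.div_add_mod (rank P below τ p + s) q
          have l := Nat.mod_lt (rank P below τ p + s) hq
          rw [h, mul_comm] at e
          omega
        · refine hinj τ (mem_filter.1 (mem_coe.1 hp)).1 (mem_filter.1 (mem_coe.1 hp')).1 ?_
          simpa using h
      simpa using this
  · have h1 : (∑ b ∈ range (#P / q + 2), (entries P blk b T : ℝ)) ≤ #P ^ 2 / q := by
      rw [le_div_iff₀ hq', mul_comm]
      have := (Nat.mul_le_mul_left q (sum_entries_le P blk T (#P / q + 2))).trans hs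
      exact_mod_cast this
    have h2 : (((#P / q : ℕ) : ℝ)) ≤ #P / q := Nat.cast_div_le
    calc _ ≤ ((∑ b ∈ range (#P / q + 2), (entries P blk b T / q + 1) : ℕ) : ℝ) := by
          refine Nat.cast_le.2 (card_biUnion_le.trans (sum_le_sum fun b _ => ?_))
          exact card_image_le.trans (by simp)
      _ ≤ ∑ b ∈ range (#P / q + 2), ((entries P blk b T : ℝ) / q + 1) := by
          push_cast
          refine sum_le_sum fun b _ => ?_
          gcongr
          exact Nat.cast_div_le
      _ = (∑ b ∈ range (#P / q + 2), (entries P blk b T : ℝ)) / q + ((#P / q : ℕ) + 2) := by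
          rw [sum_add_distrib, sum_div]; simp
      _ ≤ (#P ^ 2 / q) / q + (#P / q + 2) := by gcongr
      _ = _ := by field_simp; ring

end Sweep

/-! ### Lines in coordinates. -/

section Geometry

theorem direction_eq_span_of_mem (l : Line) {p q : Plane} (hpq : p ≠ q) (hp : p ∈ l.1)
    (hq : q ∈ l.1) : l.1.direction = Submodule.span ℝ {q -ᵥ p} := by
  refine (Submodule.eq_of_le_of_finrank_eq ?_ ?_).symm
  · rw [Submodule.span_singleton_le_iff_mem]
    exact AffineSubspace.vsub_mem_direction hq hp
  · rw [finrank_span_singleton (vsub_ne_zero.2 hpq.symm), l.2]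

theorem eq_of_mem_of_mem {p q : Plane} {a b : Line} (hab : a ≠ b) (hpa : p ∈ a.1) (hpb : p ∈ b.1)
    (hqa : q ∈ a.1) (hqb : q ∈ b.1) : p = q := by
  by_contra hpq
  refine hab (Subtype.ext (AffineSubspace.ext_of_direction_eq ?_ ⟨p, hpa, hpb⟩))
  rw [direction_eq_span_of_mem a hpq hpa hqa, direction_eq_span_of_mem b hpq hpb hqb]

/-- Every line is a graph over the first coordinate or vertical. -/
theorem exists_equation (l : Line) : (∃ s c : ℝ, ∀ p : Plane, p ∈ l.1 ↔ p 1 = s * p 0 + c) ∨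
    ∃ c : ℝ, ∀ p : Plane, p ∈ l.1 ↔ p 0 = c := by
  obtain ⟨v, hv, hspan⟩ := finrank_eq_one_iff'.1 l.2
  have hv' : (v : Plane) ≠ 0 := fun h => hv (Subtype.ext h)
  obtain ⟨o, ho⟩ : (l.1 : Set Plane).Nonempty := by
    by_contra h
    rw [Set.not_nonempty_iff_eq_empty, AffineSubspace.coe_eq_bot_iff] at h
    have := l.2
    rw [h, AffineSubspace.direction_bot] at this
    simp at this
  have hmem : ∀ p : Plane, p ∈ l.1 ↔ ∃ k : ℝ, p 0 = k * (v : Plane) 0 + o 0 ∧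
      p 1 = k * (v : Plane) 1 + o 1 := by
    intro p
    rw [← AffineSubspace.vsub_right_mem_direction_iff_mem ho]
    constructor
    · intro hp
      obtain ⟨k, hk⟩ := hspan ⟨p -ᵥ o, hp⟩
      have hk' : k • (v : Plane) = p - o := congrArg Subtype.val hk
      refine ⟨k, ?_, ?_⟩
      · have := congrArg (fun x : Plane => x 0) hk'
        simp at this
        linarith
      · have := congrArg (fun x : Plane => x 1) hk'
        simp at this
        linarith
    · rintro ⟨k, h0, h1⟩
      have : p -ᵥ o = k • (v : Plane) := by
        ext i
        fin_cases i
        · simp [h0]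
        · simp [h1]
      rw [this]
      exact Submodule.smul_mem _ _ v.2
  by_cases h0 : (v : Plane) 0 = 0
  · right
    have h1 : (v : Plane) 1 ≠ 0 := by
      intro h1
      refine hv' ?_
      ext i
      fin_cases i
      · simpa using h0
      · simpa using h1
    refine ⟨o 0, fun p => ?_⟩
    rw [hmem]
    constructor
    · rintro ⟨k, hk, _⟩
      simpa [h0] using hk
    · intro hp
      exact ⟨(p 1 - o 1) / (v : Plane) 1, by simp [h0, hp], by field_simp; ring⟩
  · left
    refine ⟨(v : Plane) 1 / (v : Plane) 0, o 1 - (v : Plane) 1 / (v : Plane) 0 * o 0, fun p => ?_⟩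
    rw [hmem]
    constructor
    · rintro ⟨k, hk0, hk1⟩
      rw [hk0, hk1]
      field_simp
      ring
    · intro hp
      refine ⟨(p 0 - o 0) / (v : Plane) 0, by field_simp; ring, ?_⟩
      rw [hp]
      field_simp
      ring

/-! ### The dual order and its sweep by slope. -/

/-- The order of the lines dual to `p` and `q` just after time `s`. -/
def DualBelow (s : ℝ) (p q : Plane) : Prop :=
  p 1 - s * p 0 < q 1 - s * q 0 ∨ (p 1 - s * p 0 = q 1 - s * q 0 ∧ q 0 < p 0)

/-- The difference of the two intercepts is affine in `s`, so it changes sign at most once, in a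
direction fixed by the first coordinates. The tie-break adopts the order that holds just after the
crossing, so ties respect this direction. -/
theorem dualBelow_monotone_or_antitone (p q : Plane) :
    Monotone (fun s => DualBelow s p q) ∨ Antitone (fun s => DualBelow s p q) := by
  rcases lt_or_ge (q 0) (p 0) with h | h
  · left
    intro x y hxy hx
    rcases lt_or_eq_of_le (show p 1 - y * p 0 ≤ q 1 - y * q 0 by
      rcases hx with hx | ⟨hx, _⟩ <;> nlinarith) with h' | h'
    · exact Or.inl h'
    · exact Or.inr ⟨h', h⟩
  · right
    intro x y hxy hy
    rcases hy with hy | ⟨_, hy⟩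
    · left
      nlinarith
    · exact absurd hy (not_lt.2 h)

theorem DualBelow.trans {s : ℝ} {p q r : Plane} (h₁ : DualBelow s p q) (h₂ : DualBelow s q r) :
    DualBelow s p r := by
  rcases h₁ with h₁ | ⟨h₁, h₁'⟩ <;> rcases h₂ with h₂ | ⟨h₂, h₂'⟩
  · exact Or.inl (h₁.trans h₂)
  · exact Or.inl (h₂ ▸ h₁)
  · exact Or.inl (h₁ ▸ h₂)
  · exact Or.inr ⟨h₁.trans h₂, h₂'.trans h₁'⟩

theorem not_dualBelow_self (s : ℝ) (p : Plane) : ¬ DualBelow s p p := by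
  rintro (h | ⟨_, h⟩) <;> exact lt_irrefl _ h

theorem dualBelow_or_dualBelow (s : ℝ) {p q : Plane} (hpq : p ≠ q) :
    DualBelow s p q ∨ DualBelow s q p := by
  rcases lt_trichotomy (p 1 - s * p 0) (q 1 - s * q 0) with h | h | h
  · exact Or.inl (Or.inl h)
  · rcases lt_trichotomy (p 0) (q 0) with h' | h' | h'
    · exact Or.inr (Or.inr ⟨h.symm, h'⟩)
    · refine absurd ?_ hpq
      ext i
      fin_cases i
      · exact h'
      · rw [h'] at h
        simpa using h
    · exact Or.inl (Or.inr ⟨h, h'⟩)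
  · exact Or.inr (Or.inl h)

theorem rank_dualBelow_injOn (P : Finset Plane) (x : ℕ → ℝ) (τ : ℕ) :
    Set.InjOn (rank P (fun τ => DualBelow (x τ)) τ) P := by
  classical
  have hlt : ∀ p ∈ P, ∀ q, DualBelow (x τ) p q →
      rank P (fun τ => DualBelow (x τ)) τ p < rank P (fun τ => DualBelow (x τ)) τ q := by
    intro p hp q hpq
    refine card_lt_card (ssubset_iff_of_subset ?_ |>.2 ⟨p, mem_filter.2 ⟨hp, hpq⟩, fun h =>
      not_dualBelow_self _ _ (mem_filter.1 h).2⟩)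
    intro r hr
    rw [mem_filter] at hr ⊢
    exact ⟨hr.1, hr.2.trans hpq⟩
  intro p hp q hq h
  by_contra hpq
  rcases dualBelow_or_dualBelow (x τ) hpq with h' | h'
  · exact (hlt p hp q h').ne h
  · exact (hlt q hq p h').ne' h

open Classical in
/-- At the time given by its slope, the points of a line have consecutive ranks. -/
theorem rank_mem_Ico_of_mem_line (P : Finset Plane) (x : ℕ → ℝ) (τ : ℕ) (c : ℝ) (p : Plane)
    (hp : p ∈ P) (hpc : p 1 = x τ * p 0 + c) :
    #{r ∈ P | r 1 - x τ * r 0 < c} ≤ rank P (fun τ => DualBelow (x τ)) τ p ∧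
    rank P (fun τ => DualBelow (x τ)) τ p <
      #{r ∈ P | r 1 - x τ * r 0 < c} + #{r ∈ P | r 1 = x τ * r 0 + c} := by
  have hpc' : p 1 - x τ * p 0 = c := by linarith
  constructor
  · refine card_le_card fun r hr => ?_
    rw [mem_filter] at hr ⊢
    exact ⟨hr.1, Or.inl (by rw [hpc']; exact hr.2)⟩
  · rw [← card_union_of_disjoint]
    · refine card_lt_card (ssubset_iff_of_subset ?_ |>.2
        ⟨p, mem_union_right _ (mem_filter.2 ⟨hp, hpc⟩), fun h =>
          not_dualBelow_self _ _ (mem_filter.1 h).2⟩)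
      intro r hr
      obtain ⟨hrP, hr⟩ := mem_filter.1 hr
      rw [mem_union, mem_filter, mem_filter]
      rcases hr with hr | ⟨hr, _⟩
      · exact Or.inl ⟨hrP, by rwa [hpc'] at hr⟩
      · exact Or.inr ⟨hrP, by rw [hpc'] at hr; linarith⟩
    · refine disjoint_left.2 fun r h1 h2 => ?_
      have h1 := (mem_filter.1 h1).2
      have h2 := (mem_filter.1 h2).2
      linarith

/-- A finite set of reals can be listed in increasing order. -/
theorem exists_monotone_enumeration (S : Finset ℝ) :
    ∃ (x : ℕ → ℝ) (T : ℕ), Monotone x ∧ ∀ s ∈ S, ∃ τ < T, x τ = s := by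
  rcases S.eq_empty_or_nonempty with rfl | hne
  · exact ⟨fun _ => 0, 0, monotone_const, by simp⟩
  have hpos : 0 < #S := hne.card_pos
  -- Capping the index freezes the sequence at the maximum of `S`, which keeps it monotone on all of
  -- `ℕ`.
  refine ⟨fun k => S.orderEmbOfFin rfl ⟨min k (#S - 1), by omega⟩, #S, ?_, fun s hs => ?_⟩
  · intro i j hij
    refine (S.orderEmbOfFin rfl).monotone ?_
    rw [Fin.mk_le_mk]
    omega
  · have : s ∈ Set.range (S.orderEmbOfFin rfl) := by rw [range_orderEmbOfFin]; exact hs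
    obtain ⟨i, hi⟩ := this
    refine ⟨i, i.2, ?_⟩
    rw [← hi]
    have := i.2
    exact congrArg _ (Fin.ext (by simp only; omega))

/-! ### Elementary incidence counts. -/

open Classical in
/-- The number of incidences between `P` and `L`. -/
noncomputable def numInc (P : Finset Plane) (L : Finset Line) : ℕ :=
  #{x ∈ P ×ˢ L | x.1 ∈ x.2.1}

open Classical in
theorem numInc_eq_sum_points (P : Finset Plane) (L : Finset Line) :
    numInc P L = ∑ p ∈ P, #{l ∈ L | p ∈ l.1} := by
  simp only [numInc, card_filter, sum_product]

open Classical in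
theorem numInc_eq_sum_lines (P : Finset Plane) (L : Finset Line) :
    numInc P L = ∑ l ∈ L, #{p ∈ P | p ∈ l.1} := by
  simp only [numInc, card_filter, sum_product_right]

theorem coe_incidences (P : Finset Plane) (L : Finset Line) :
    (incidences (P : Set Plane) (L : Set Line)).ncard = numInc P L := by
  classical
  rw [numInc, ← Set.ncard_coe_finset]
  congr 1
  ext x
  simp [incidences, and_assoc]

open Classical in
theorem numInc_filter_add (P : Finset Plane) (L : Finset Line) (Q : Line → Prop) :
    numInc P L = numInc P {l ∈ L | Q l} + numInc P {l ∈ L | ¬ Q l} := by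
  simp only [numInc_eq_sum_lines]
  exact (sum_filter_add_sum_filter_not L Q _).symm

open Classical in
-- Two distinct points lie on at most one common line, so the sets of ordered pairs on different
-- lines are disjoint.
theorem sum_card_offDiag_le (P : Finset Plane) (L : Finset Line) :
    ∑ l ∈ L, #{p ∈ P | p ∈ l.1} * (#{p ∈ P | p ∈ l.1} - 1) ≤ #P ^ 2 := by
  have h : ∀ l ∈ L, #{p ∈ P | p ∈ l.1} * (#{p ∈ P | p ∈ l.1} - 1) =
      #({p ∈ P | p ∈ l.1} : Finset Plane).offDiag := by
    intro l _
    rw [offDiag_card, Nat.mul_sub_one]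
  rw [sum_congr rfl h, ← card_biUnion]
  · refine (card_le_card (t := P ×ˢ P) fun x hx => ?_).trans (by rw [card_product, sq])
    obtain ⟨l, _, hx⟩ := mem_biUnion.1 hx
    rw [mem_offDiag, mem_filter, mem_filter] at hx
    exact mem_product.2 ⟨hx.1.1, hx.2.1.1⟩
  · intro a _ b _ hab
    refine disjoint_left.2 fun x hx hx' => ?_
    rw [mem_offDiag, mem_filter, mem_filter] at hx hx'
    exact hx.2.2 (eq_of_mem_of_mem hab hx.1.2 hx'.1.2 hx.2.1.2 hx'.2.1.2)

/-- Pointwise `d ≤ 1 + d (d - 1)`, summed over the lines. -/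
theorem numInc_le_card_add_sq (P : Finset Plane) (L : Finset Line) :
    numInc P L ≤ #L + #P ^ 2 := by
  classical
  refine le_trans ?_ (Nat.add_le_add_left (sum_card_offDiag_le P L) _)
  rw [numInc_eq_sum_lines, card_eq_sum_ones, ← sum_add_distrib]
  refine sum_le_sum fun l _ => ?_
  rcases #{p ∈ P | p ∈ l.1} with _ | _ | k
  · simp
  · simp
  · simp only [Nat.add_sub_cancel]
    nlinarith

open Classical in
-- A line with `d > q` points has `q d ≤ d (d - 1)` ordered pairs, and pairs are counted once.
theorem mul_numInc_rich_le (P : Finset Plane) (L : Finset Line) (q : ℕ) :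
    q * numInc P {l ∈ L | ¬ #{p ∈ P | p ∈ l.1} ≤ q} ≤ #P ^ 2 := by
  refine le_trans ?_ (sum_card_offDiag_le P {l ∈ L | ¬ #{p ∈ P | p ∈ l.1} ≤ q})
  rw [numInc_eq_sum_lines, mul_sum]
  refine sum_le_sum fun l hl => ?_
  have := (mem_filter.1 hl).2
  rw [mul_comm]
  exact Nat.mul_le_mul_left _ (by omega)

theorem numInc_vertical_le (P : Finset Plane) (L : Finset Line)
    (hL : ∀ l ∈ L, ∃ c : ℝ, ∀ p : Plane, p ∈ l.1 ↔ p 0 = c) : numInc P L ≤ #P := by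
  classical
  rw [numInc_eq_sum_points, card_eq_sum_ones]
  refine sum_le_sum fun p _ => card_le_one.2 fun a ha b hb => ?_
  obtain ⟨haL, ha⟩ := mem_filter.1 ha
  obtain ⟨hbL, hb⟩ := mem_filter.1 hb
  obtain ⟨c, hc⟩ := hL a haL
  obtain ⟨d, hd⟩ := hL b hbL
  refine Subtype.ext (SetLike.ext fun r => ?_)
  rw [hc, hd, ← (hc p).1 ha, ← (hd p).1 hb]

/-! ### Incidence bounds for grid-free configurations. -/

/-- `(P, L)` contains no `t × t` grid. -/
def GridFree (t : ℕ) (P : Finset Plane) (L : Finset Line) : Prop :=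
  ¬ ∃ (a b : Fin t → Line) (p : Fin t → Fin t → Plane), (∀ i, a i ∈ L) ∧ (∀ i, b i ∈ L) ∧
      (∀ i j, p i j ∈ P) ∧ IsGrid (fun (p : Plane) (l : Line) => p ∈ l.1) a b p

theorem GridFree.mono {t : ℕ} {P P' : Finset Plane} {L L' : Finset Line} (h : GridFree t P L)
    (hP : P' ⊆ P) (hL : L' ⊆ L) : GridFree t P' L' :=
  fun ⟨a, b, p, ha, hb, hp, hg⟩ =>
    h ⟨a, b, p, fun i => hL (ha i), fun i => hL (hb i), fun i j => hP (hp i j), hg⟩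

theorem GridFree.numInc_le {t : ℕ} {P : Finset Plane} {L : Finset Line} (h : GridFree t P L)
    (ht : 1 ≤ t) : (numInc P L : ℝ) ≤ #P + 4 * t * (#L : ℝ) ^ (2 - 1 / (t : ℝ)) := by
  rw [numInc_eq_sum_points]
  push_cast
  exact sum_card_inc_le_of_no_grid _
    (fun p q a b hab h1 h2 h3 h4 => eq_of_mem_of_mem hab h1 h2 h3 h4) t ht P L h

theorem GridFree.numInc_le_of_split {t : ℕ} {P : Finset Plane} {L : Finset Line}
    (h : GridFree t P L) (ht : 1 ≤ t) (w : ℕ) (hw : 1 ≤ w) :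
    (numInc P L : ℝ) ≤ (#L / w + 1) * (#P + 4 * t * (w : ℝ) ^ (2 - 1 / (t : ℝ))) := by
  rw [numInc_eq_sum_points]
  push_cast
  exact sum_card_inc_le_of_no_grid_of_split _
    (fun p q a b hab h1 h2 h3 h4 => eq_of_mem_of_mem hab h1 h2 h3 h4) t ht w hw P L h

/-- A run of at most `q` consecutive ranks meets at most two blocks of length `q`. -/
theorem add_div_eq_or_eq {a r s q d : ℕ} (hq : 1 ≤ q) (h1 : a ≤ r) (h2 : r < a + d) (hd : d ≤ q) :
    (r + s) / q = (a + s) / q ∨ (r + s) / q = (a + s) / q + 1 := by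
  have h3 : (a + s) / q ≤ (r + s) / q := Nat.div_le_div_right (by omega)
  have h4 : (r + s) / q ≤ (a + s + q) / q := Nat.div_le_div_right (by omega)
  rw [Nat.add_div_right _ (by omega)] at h4
  omega

open Classical in
/-- The incidence bound for non-vertical lines with at most `q` points each, by a cutting. -/
theorem GridFree.numInc_le_of_cutting {t : ℕ} {P : Finset Plane} {L : Finset Line}
    (h : GridFree t P L) (ht : 1 ≤ t) (q w : ℕ) (hq : 1 ≤ q) (hw : 1 ≤ w)
    (hL : ∀ l ∈ L, ∃ s c : ℝ, ∀ p : Plane, p ∈ l.1 ↔ p 1 = s * p 0 + c)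
    (hpoor : ∀ l ∈ L, #{p ∈ P | p ∈ l.1} ≤ q) :
    (numInc P L : ℝ) ≤ (2 * #L / w + (#P / q + 2 + #P ^ 2 / q ^ 2)) *
      (2 * q + 4 * t * (w : ℝ) ^ (2 - 1 / (t : ℝ))) := by
  choose! slope icpt hl using hL
  -- The times of the sweep are the slopes that occur in `L`, so every line has a time of its own
  -- slope.
  obtain ⟨x, T, hx, hT⟩ := exists_monotone_enumeration (L.image slope)
  have hT' : ∀ l ∈ L, ∃ τ < T, x τ = slope l := fun l hlL => hT _ (mem_image_of_mem _ hlL)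
  choose! time htime hslope using hT'
  obtain ⟨s, g, K, hK, hcard, hKcard⟩ := exists_sweep_partition P (fun τ => DualBelow (x τ))
    (fun p q => (dualBelow_monotone_or_antitone p q).imp
      (fun h => h.comp hx) (fun h => h.comp_monotone hx)) (rank_dualBelow_injOn P x) T q hq
  set key : ℕ → Plane → ℕ × ℕ := fun τ p =>
    ((rank P (fun τ => DualBelow (x τ)) τ p + s) / q,
      g ((rank P (fun τ => DualBelow (x τ)) τ p + s) / q) τ) with hkey
  set Pc : ℕ × ℕ → Finset Plane := fun κ => {p ∈ P | ∃ τ < T, key τ p = κ} with hPc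
  set Lc : ℕ × ℕ → Finset Line := fun κ =>
    {l ∈ L | ∃ p ∈ P, p ∈ l.1 ∧ key (time l) p = κ} with hLc
  -- An incidence is charged to the cell that contains its point at the time of its line.
  have hsplit : numInc P L ≤ ∑ κ ∈ K, numInc (Pc κ) (Lc κ) := by
    refine le_trans (card_le_card ?_) card_biUnion_le
    rintro ⟨p, l⟩ hpl
    obtain ⟨hpl, hinc⟩ := mem_filter.1 hpl
    obtain ⟨hp, hlL⟩ := mem_product.1 hpl
    refine mem_biUnion.2 ⟨key (time l) p, hK _ (htime l hlL) p hp, mem_filter.2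
      ⟨mem_product.2 ⟨mem_filter.2 ⟨hp, time l, htime l hlL, rfl⟩,
        mem_filter.2 ⟨hlL, p, hp, hinc, rfl⟩⟩, hinc⟩⟩
  -- At its own slope a line has its at most `q` points in consecutive ranks starting at `base`;
  -- these lie in the block of `base` or the next, hence in two cells.
  have hLsum : ∑ κ ∈ K, #(Lc κ) ≤ 2 * #L := by
    have e := sum_card_bipartiteAbove_eq_sum_card_bipartiteBelow (s := K) (t := L)
      (fun κ l => ∃ p ∈ P, p ∈ l.1 ∧ key (time l) p = κ)
    refine (le_of_eq e).trans ?_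
    rw [mul_comm, ← smul_eq_mul, ← sum_const]
    refine sum_le_sum fun l hlL => ?_
    set base := #{r ∈ P | r 1 - x (time l) * r 0 < icpt l} with hbase
    refine (card_le_card (t := {((base + s) / q, g ((base + s) / q) (time l)),
      ((base + s) / q + 1, g ((base + s) / q + 1) (time l))}) ?_).trans card_le_two
    intro κ hκ
    obtain ⟨_, p, hp, hpl, rfl⟩ := mem_filter.1 hκ
    have heq : ∀ r : Plane, r ∈ l.1 ↔ r 1 = x (time l) * r 0 + icpt l := by
      intro r
      rw [hl l hlL, hslope l hlL]
    obtain ⟨h1, h2⟩ := rank_mem_Ico_of_mem_line P x (time l) (icpt l) p hp ((heq p).1 hpl)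
    have hd : #{r ∈ P | r 1 = x (time l) * r 0 + icpt l} ≤ q := by
      refine le_trans (le_of_eq ?_) (hpoor l hlL)
      congr 1
      ext r
      simp only [mem_filter, heq]
    rw [mem_insert, mem_singleton]
    rcases add_div_eq_or_eq (s := s) hq h1 h2 hd with h3 | h3
    · left
      simp only [hkey]
      rw [h3]
    · right
      simp only [hkey]
      rw [h3]
  have hw' : (0 : ℝ) < w := by exact_mod_cast hw
  set D : ℝ := 2 * q + 4 * t * (w : ℝ) ^ (2 - 1 / (t : ℝ)) with hD
  have hD0 : 0 ≤ D := by positivity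
  calc (numInc P L : ℝ) ≤ ∑ κ ∈ K, (numInc (Pc κ) (Lc κ) : ℝ) := by exact_mod_cast hsplit
    _ ≤ ∑ κ ∈ K, ((#(Lc κ) : ℝ) / w + 1) * D := by
        refine sum_le_sum fun κ _ => ?_
        have hfree : GridFree t (Pc κ) (Lc κ) := h.mono (filter_subset _ _) (filter_subset _ _)
        have : (#(Pc κ) : ℝ) ≤ 2 * q := by exact_mod_cast hcard κ
        exact (hfree.numInc_le_of_split ht w hw).trans
          (mul_le_mul_of_nonneg_left (by linarith) (by positivity))
    _ = ((∑ κ ∈ K, (#(Lc κ) : ℝ)) / w + #K) * D := by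
        rw [← sum_mul, sum_add_distrib, sum_div]; simp
    _ ≤ _ := by
        have : (∑ κ ∈ K, (#(Lc κ) : ℝ)) ≤ 2 * #L := by exact_mod_cast hLsum
        gcongr

/-- The incidence bound with free parameters `q` and `w`. -/
theorem GridFree.numInc_le_of_parameters {t : ℕ} {P : Finset Plane} {L : Finset Line}
    (h : GridFree t P L) (ht : 1 ≤ t) (q w : ℕ) (hq : 1 ≤ q) (hw : 1 ≤ w) :
    (numInc P L : ℝ) ≤ #P + #P ^ 2 / q + (2 * #L / w + (#P / q + 2 + #P ^ 2 / q ^ 2)) *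
      (2 * q + 4 * t * (w : ℝ) ^ (2 - 1 / (t : ℝ))) := by
  classical
  have hq' : (0 : ℝ) < q := by exact_mod_cast hq
  have hw' : (0 : ℝ) < w := by exact_mod_cast hw
  obtain ⟨Q, hQ⟩ : ∃ Q : Line → Prop, ∀ l, Q l ↔
    ∃ s c : ℝ, ∀ p : Plane, p ∈ l.1 ↔ p 1 = s * p 0 + c := ⟨_, fun _ => Iff.rfl⟩
  set L₁ : Finset Line := {l ∈ L | Q l} with hL₁
  have hsub : ({l ∈ L₁ | #{p ∈ P | p ∈ l.1} ≤ q} : Finset Line) ⊆ L :=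
    (filter_subset _ _).trans (filter_subset _ _)
  have e1 : numInc P L = numInc P L₁ + numInc P {l ∈ L | ¬ Q l} := numInc_filter_add P L Q
  have e2 : numInc P L₁ = numInc P {l ∈ L₁ | #{p ∈ P | p ∈ l.1} ≤ q} +
      numInc P {l ∈ L₁ | ¬ #{p ∈ P | p ∈ l.1} ≤ q} := by
    convert numInc_filter_add P L₁ (fun l => #{p ∈ P | p ∈ l.1} ≤ q)
  have h1 := numInc_vertical_le P {l ∈ L | ¬ Q l}
    (fun l hl => (exists_equation l).resolve_left (fun h => (mem_filter.1 hl).2 ((hQ l).2 h)))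
  have h2 := mul_numInc_rich_le P L₁ q
  have h3 := (h.mono subset_rfl hsub).numInc_le_of_cutting ht q w hq hw
    (fun l hl => (hQ l).1 (mem_filter.1 (mem_filter.1 hl).1).2) (fun l hl => (mem_filter.1 hl).2)
  have h2' : (numInc P {l ∈ L₁ | ¬ #{p ∈ P | p ∈ l.1} ≤ q} : ℝ) ≤ #P ^ 2 / q := by
    rw [le_div_iff₀ hq', mul_comm]
    exact_mod_cast h2
  have h4 : (#({l ∈ L₁ | #{p ∈ P | p ∈ l.1} ≤ q} : Finset Line) : ℝ) ≤ #L := by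
    exact_mod_cast card_le_card hsub
  have h5 : (2 * #({l ∈ L₁ | #{p ∈ P | p ∈ l.1} ≤ q} : Finset Line) / w +
      (#P / q + 2 + #P ^ 2 / q ^ 2)) * (2 * q + 4 * t * (w : ℝ) ^ (2 - 1 / (t : ℝ))) ≤
      (2 * #L / w + (#P / q + 2 + #P ^ 2 / q ^ 2)) *
      (2 * q + 4 * t * (w : ℝ) ^ (2 - 1 / (t : ℝ))) := by gcongr
  have h1' : (numInc P {l ∈ L | ¬ Q l} : ℝ) ≤ #P := by exact_mod_cast h1
  rw [e1, e2]
  push_cast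
  linarith

end Geometry

/-! ### Grids and the forbidden configuration. -/

section Isomorphism

/-- Bijections of the points and of the lines that respect incidence give an isomorphism. -/
theorem isomorphic_of_equiv {P P' : Set Plane} {L L' : Set Line} (φ : P ≃ P') (ψ : L ≃ L')
    (h : ∀ p l, p.1 ∈ l.1.1 ↔ (φ p).1 ∈ (ψ l).1.1) : Isomorphic P L P' L' := by
  have h' : ∀ (p : P) (l : L),
      ((φ p).1, (ψ l).1) ∈ incidences P' L' ↔ (p.1, l.1) ∈ incidences P L := by
    intro p l
    simp [incidences, h p l]
  refine ⟨⟨Equiv.sumCongr φ ψ, ?_⟩⟩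
  rintro (p | l) (q | k)
  · exact Iff.rfl
  · exact h' p k
  · exact h' q l
  · exact Iff.rfl

variable {t : ℕ} {a b : Fin t → Line} {p : Fin t → Fin t → Plane}

/-- The incidences of the abstract `t × t` grid. -/
def StdInc (t : ℕ) (x : Fin t × Fin t) (y : Fin t ⊕ Fin t) : Prop :=
  Sum.elim (fun k => k = x.1) (fun k => k = x.2) y

/-- The grid axioms prescribe every incidence, and distinct labels have distinct incidences, so the
labellings are injective and transport the abstract grid. -/
theorem IsGrid.exists_equiv (hg : IsGrid (fun (p : Plane) (l : Line) => p ∈ l.1) a b p)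
    (ht : 1 < t) :
    ∃ (φ : Fin t × Fin t ≃ Set.range fun x : Fin t × Fin t => p x.1 x.2)
      (ψ : Fin t ⊕ Fin t ≃ (Set.range a ∪ Set.range b : Set Line)),
      ∀ x y, (φ x).1 ∈ (ψ y).1.1 ↔ StdInc t x y := by
  have hp : Function.Injective fun x : Fin t × Fin t => p x.1 x.2 := by
    rintro ⟨i, j⟩ ⟨k, l⟩ h
    simp only at h
    have h1 := (hg.inc_left k l k).2 rfl
    have h2 := (hg.inc_right k l l).2 rfl
    simp only [← h] at h1 h2
    rw [(hg.inc_left i j k).1 h1, (hg.inc_right i j l).1 h2]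
  have hab : Function.Injective (Sum.elim a b) := by
    let z : Fin t := ⟨0, by omega⟩
    let o : Fin t := ⟨1, ht⟩
    have hzo : z ≠ o := by simp [z, o, Fin.ext_iff]
    -- A common line would contain `p i l` for every `l`, which forces all indices `l` to agree;
    -- this is where `1 < t` enters.
    have hne : ∀ i j, a i ≠ b j := by
      intro i j h
      have h1 : ∀ l, j = l := fun l => (hg.inc_right i l j).1 (by
        simp only [← h]; exact (hg.inc_left i l i).2 rfl)
      exact hzo ((h1 z).symm.trans (h1 o))
    refine Function.Injective.sumElim ?_ ?_ hne
    · intro i k h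
      exact (hg.inc_left k z i).1 (by simp only [h]; exact (hg.inc_left k z k).2 rfl)
    · intro i k h
      exact (hg.inc_right z k i).1 (by simp only [h]; exact (hg.inc_right z k k).2 rfl)
  refine ⟨Equiv.ofInjective _ hp,
    (Equiv.ofInjective _ hab).trans (Equiv.setCongr (Set.Sum.elim_range a b)), ?_⟩
  rintro ⟨i, j⟩ (k | k)
  · exact hg.inc_left i j k
  · exact hg.inc_right i j k

/-- Any two `t × t` grids are isomorphic. -/
theorem IsGrid.isomorphic {a' b' : Fin t → Line} {p' : Fin t → Fin t → Plane} (ht : 1 < t)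
    (hg : IsGrid (fun (p : Plane) (l : Line) => p ∈ l.1) a b p)
    (hg' : IsGrid (fun (p : Plane) (l : Line) => p ∈ l.1) a' b' p') :
    Isomorphic (Set.range fun x : Fin t × Fin t => p x.1 x.2) (Set.range a ∪ Set.range b)
      (Set.range fun x : Fin t × Fin t => p' x.1 x.2) (Set.range a' ∪ Set.range b') := by
  obtain ⟨φ, ψ, h⟩ := hg.exists_equiv ht
  obtain ⟨φ', ψ', h'⟩ := hg'.exists_equiv ht
  refine isomorphic_of_equiv (φ.symm.trans φ') (ψ.symm.trans ψ') fun p l => ?_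
  rw [Equiv.trans_apply, Equiv.trans_apply, h', ← h, Equiv.apply_symm_apply,
    Equiv.apply_symm_apply]

/-- Two families of `t` lines with `t ^ 2` crossings form a grid. -/
theorem exists_isGrid_of_ncard_crossings (L₁ L₂ : Finset Line) (h₁ : #L₁ = t) (h₂ : #L₂ = t)
    (h : (crossings (L₁ : Set Line) (L₂ : Set Line)).ncard = t ^ 2) :
    ∃ (a b : Fin t → Line) (p : Fin t → Fin t → Plane),
      IsGrid (fun (p : Plane) (l : Line) => p ∈ l.1) a b p ∧
      (Set.range fun x : Fin t × Fin t => p x.1 x.2) = crossings (L₁ : Set Line) (L₂ : Set Line) ∧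
      Set.range a ∪ Set.range b = (L₁ : Set Line) ∪ (L₂ : Set Line) := by
  classical
  let cross : Line × Line → Plane → Prop := fun x p =>
    (x.1.1 : Set Plane) ∩ (x.2.1 : Set Plane) = {p}
  -- The value `0` is a dummy for pairs that do not meet in exactly one point.
  have hchoice : ∀ x : Line × Line, ∃ p : Plane, (∃ q, cross x q) → cross x p := by
    intro x
    by_cases hx : ∃ q, cross x q
    · exact ⟨hx.choose, fun _ => hx.choose_spec⟩
    · exact ⟨0, fun h => absurd h hx⟩
  choose g hg using hchoice
  set D : Finset (Line × Line) := {x ∈ L₁ ×ˢ L₂ | ∃ q, cross x q} with hD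
  have hC : crossings (L₁ : Set Line) (L₂ : Set Line) = (D.image g : Finset Plane) := by
    ext p
    rw [mem_coe, mem_image]
    constructor
    · rintro ⟨l₁, hl₁, l₂, hl₂, hp⟩
      refine ⟨(l₁, l₂), mem_filter.2 ⟨mem_product.2 ⟨hl₁, hl₂⟩, p, hp⟩, ?_⟩
      exact Set.singleton_injective ((hg (l₁, l₂) ⟨p, hp⟩).symm.trans hp)
    · rintro ⟨⟨l₁, l₂⟩, hx, rfl⟩
      obtain ⟨hx, hq⟩ := mem_filter.1 hx
      obtain ⟨hl₁, hl₂⟩ := mem_product.1 hx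
      exact ⟨l₁, hl₁, l₂, hl₂, hg (l₁, l₂) hq⟩
  rw [hC, Set.ncard_coe_finset] at h
  have hprod : #(L₁ ×ˢ L₂) = t ^ 2 := by rw [card_product, h₁, h₂, sq]
  have hle : #(D.image g) ≤ #D := card_image_le
  -- There are only `t ^ 2` pairs, so `t ^ 2` crossings force every pair to cross, and different
  -- pairs to cross at different points.
  have hDeq : D = L₁ ×ˢ L₂ := eq_of_subset_of_card_le (filter_subset _ _) (by omega)
  have hinj : Set.InjOn g D := card_image_iff.1 (by rw [h, hDeq, hprod])
  let e₁ := L₁.equivFinOfCardEq h₁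
  let e₂ := L₂.equivFinOfCardEq h₂
  let a : Fin t → Line := fun i => (e₁.symm i).1
  let b : Fin t → Line := fun i => (e₂.symm i).1
  have hmem : ∀ i j, (a i, b j) ∈ D := fun i j => by
    rw [hDeq]; exact mem_product.2 ⟨(e₁.symm i).2, (e₂.symm j).2⟩
  have hcross : ∀ i j, cross (a i, b j) (g (a i, b j)) :=
    fun i j => hg _ (mem_filter.1 (hmem i j)).2
  have ha : Function.Injective a := Subtype.val_injective.comp e₁.symm.injective
  have hb : Function.Injective b := Subtype.val_injective.comp e₂.symm.injective
  have hpa : ∀ i j, g (a i, b j) ∈ (a i).1 ∧ g (a i, b j) ∈ (b j).1 := by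
    intro i j
    have : g (a i, b j) ∈ ((a i).1 : Set Plane) ∩ ((b j).1 : Set Plane) := by
      rw [show _ = _ from hcross i j]; exact Set.mem_singleton _
    exact this
  have huniq : ∀ i j q, q ∈ (a i).1 → q ∈ (b j).1 → q = g (a i, b j) := by
    intro i j q h1 h2
    have : q ∈ ((a i).1 : Set Plane) ∩ ((b j).1 : Set Plane) := ⟨h1, h2⟩
    rw [show _ = _ from hcross i j] at this
    exact this
  have hra : Set.range a = L₁ := by
    ext l
    constructor
    · rintro ⟨i, rfl⟩
      exact (e₁.symm i).2
    · intro hl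
      exact ⟨e₁ ⟨l, hl⟩, by simp [a]⟩
  have hrb : Set.range b = L₂ := by
    ext l
    constructor
    · rintro ⟨i, rfl⟩
      exact (e₂.symm i).2
    · intro hl
      exact ⟨e₂ ⟨l, hl⟩, by simp [b]⟩
  refine ⟨a, b, fun i j => g (a i, b j), ⟨fun i j k => ⟨fun hk => ?_, ?_⟩,
    fun i j k => ⟨fun hk => ?_, ?_⟩⟩, ?_, by rw [hra, hrb]⟩
  · have := hinj (hmem i j) (hmem k j) (huniq k j _ hk (hpa i j).2)
    exact ha (congrArg Prod.fst this).symm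
  · rintro rfl
    exact (hpa k j).1
  · have := hinj (hmem i j) (hmem i k) (huniq i k _ (hpa i j).1 hk)
    exact hb (congrArg Prod.snd this).symm
  · rintro rfl
    exact (hpa i k).2
  · rw [hC]
    ext q
    rw [mem_coe, mem_image]
    constructor
    · rintro ⟨⟨i, j⟩, rfl⟩
      exact ⟨_, hmem i j, rfl⟩
    · rintro ⟨⟨l₁, l₂⟩, hx, rfl⟩
      rw [hDeq] at hx
      obtain ⟨hl₁, hl₂⟩ := mem_product.1 hx
      obtain ⟨i, rfl⟩ : l₁ ∈ Set.range a := by rw [hra]; exact hl₁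
      obtain ⟨j, rfl⟩ : l₂ ∈ Set.range b := by rw [hrb]; exact hl₂
      exact ⟨(i, j), rfl⟩

theorem gridFree_of_not_containsCopy (ht : 1 < t) (L₁ L₂ : Finset Line) (h₁ : #L₁ = t)
    (h₂ : #L₂ = t) (h : (crossings (L₁ : Set Line) (L₂ : Set Line)).ncard = t ^ 2)
    (P : Finset Plane) (L : Finset Line)
    (hcopy : ¬ ContainsCopy (P : Set Plane) (L : Set Line)
      (crossings (L₁ : Set Line) (L₂ : Set Line)) ((L₁ : Set Line) ∪ (L₂ : Set Line))) :
    GridFree t P L := by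
  rintro ⟨a, b, p, ha, hb, hp, hg⟩
  obtain ⟨a', b', p', hg', hpts, hlines⟩ := exists_isGrid_of_ncard_crossings L₁ L₂ h₁ h₂ h
  refine hcopy ⟨Set.range fun x : Fin t × Fin t => p x.1 x.2, ?_, Set.range a ∪ Set.range b, ?_, ?_⟩
  · rintro _ ⟨x, rfl⟩
    exact hp _ _
  · rintro _ (⟨i, rfl⟩ | ⟨i, rfl⟩)
    · exact ha i
    · exact hb i
  · rw [← hpts, ← hlines]
    exact hg.isomorphic ht hg'

end Isomorphism

/-! ### Choice of the parameters. -/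

section Optimization

/-- The value of the cutting parameter `r` that balances the two terms of the bound. -/
theorem exists_balancing_parameter (t m n : ℝ) (ht : 1 < t) (hm : 0 < m) (hn : 0 < n) :
    ∃ r : ℝ, 0 < r ∧
      m ^ ((2 * t - 2) / (3 * t - 2)) * n ^ ((2 * t - 1) / (3 * t - 2)) = r * m ∧
      (n / r ^ 2) ^ (2 - 1 / t) = m / r ∧
      n ^ (2 - 1 / t) = m * r ^ ((3 * t - 2) / t) ∧
      (n ≤ m ^ 2 → r ^ 2 ≤ n) := by
  -- In logarithmic coordinates all claims become linear in `x` and `y`.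
  obtain ⟨x, rfl⟩ : ∃ x, m = Real.exp x := ⟨Real.log m, (Real.exp_log hm).symm⟩
  obtain ⟨y, rfl⟩ : ∃ y, n = Real.exp y := ⟨Real.log n, (Real.exp_log hn).symm⟩
  obtain ⟨d, hd⟩ : ∃ d, d = 3 * t - 2 := ⟨_, rfl⟩
  have hd0 : 0 < d := by linarith
  simp only [← hd]
  have h2 : t ≠ 0 := by linarith
  -- This is `r = n ^ ((2t-1)/(3t-2)) * m ^ (-t/(3t-2))`, the solution of `(n / r ^ 2) ^ (2 - 1/t) =
  -- m / r`.
  refine ⟨Real.exp ((2 * t - 1) / d * y - t / d * x), Real.exp_pos _,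
    ?_, ?_, ?_, ?_⟩
  · simp only [← Real.exp_mul, ← Real.exp_add]
    congr 1
    field_simp
    rw [hd]
    ring
  · rw [← Real.exp_nat_mul, ← Real.exp_sub, ← Real.exp_mul, ← Real.exp_sub]
    congr 1
    push_cast
    field_simp
    rw [hd]
    ring
  · simp only [← Real.exp_mul, ← Real.exp_add]
    congr 1
    field_simp
    ring
  · rw [← Real.exp_nat_mul, ← Real.exp_nat_mul, Real.exp_le_exp, Real.exp_le_exp]
    push_cast
    intro h
    have e : 2 * ((2 * t - 1) / d * y - t / d * x) - y =
        t / d * (y - 2 * x) := by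
      field_simp
      rw [hd]
      ring
    have : t / d * (y - 2 * x) ≤ 0 :=
      mul_nonpos_of_nonneg_of_nonpos (by positivity) (by linarith)
    linarith

/-- With `q ≈ m/r` and `w ≈ n/r^2` there are `O(r^2)` pieces, each costing `O(t m/r)`, for a total
of `O(t r m)`. The extreme ranges `r ≤ 1` and `n > m ^ 2` are handled directly by the weak bound and
by pair counting. The constant is not optimized. -/
theorem GridFree.numInc_le_main {t : ℕ} {P : Finset Plane} {L : Finset Line}
    (h : GridFree t P L) (ht : 1 < t) :
    (numInc P L : ℝ) ≤ 200 * t *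
      ((#P : ℝ) ^ ((2 * (t : ℝ) - 2) / (3 * (t : ℝ) - 2)) *
        (#L : ℝ) ^ ((2 * (t : ℝ) - 1) / (3 * (t : ℝ) - 2)) + #P + #L) := by
  have ht' : (1 : ℝ) < t := by exact_mod_cast ht
  rcases P.eq_empty_or_nonempty with rfl | hP
  · have : numInc ∅ L = 0 := by simp [numInc]
    rw [this]
    simp only [Nat.cast_zero]
    positivity
  rcases L.eq_empty_or_nonempty with rfl | hL
  · have : numInc P ∅ = 0 := by simp [numInc]
    rw [this]
    simp only [Nat.cast_zero]
    positivity
  have hsq := numInc_le_card_add_sq P L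
  have hsq' : (numInc P L : ℝ) ≤ #L + (#P : ℝ) ^ 2 := by exact_mod_cast hsq
  have hbasic := h.numInc_le ht.le
  have hpar := h.numInc_le_of_parameters ht.le
  have hm : (0 : ℝ) < #P := by exact_mod_cast hP.card_pos
  have hn : (0 : ℝ) < #L := by exact_mod_cast hL.card_pos
  set m : ℝ := (#P : ℝ)
  set n : ℝ := (#L : ℝ)
  obtain ⟨r, hr, hmain, hbal, hbal', hrn⟩ := exists_balancing_parameter t m n ht' hm hn
  rw [hmain]
  have hrm : 0 < r * m := by positivity
  rcases le_or_gt r 1 with hr1 | hr1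
  · have : n ^ (2 - 1 / (t : ℝ)) ≤ m := by
      rw [hbal']
      refine mul_le_of_le_one_right hm.le (Real.rpow_le_one hr.le hr1 ?_)
      exact div_nonneg (by linarith) (by linarith)
    have h1 : 4 * t * n ^ (2 - 1 / (t : ℝ)) ≤ 4 * t * m := by gcongr
    have h2 : m ≤ t * m := le_mul_of_one_le_left hm.le ht'.le
    have h3 : 0 ≤ t * (r * m) := by positivity
    have h4 : 0 ≤ t * n := by positivity
    have h5 : 0 ≤ t * m := by positivity
    linarith
  rcases le_or_gt n (m ^ 2) with hnm | hnm
  swap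
  · have h2 : n ≤ t * n := le_mul_of_one_le_left hn.le ht'.le
    have h3 : 0 ≤ t * (r * m) := by positivity
    have h4 : 0 ≤ t * m := by positivity
    linarith
  -- In the remaining range `m / r` and `n / r ^ 2` are at least 1, so rounding up to integers costs
  -- at most a factor 2.
  have hrn := hrn hnm
  have hrm1 : 1 ≤ m / r := by
    rw [one_le_div hr]
    exact le_of_sq_le_sq (hrn.trans hnm) hm.le
  have hrn1 : 1 ≤ n / r ^ 2 := by rwa [one_le_div (by positivity)]
  have hq1 := Nat.le_ceil (m / r)
  have hq2 : (⌈m / r⌉₊ : ℝ) ≤ 2 * (m / r) := by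
    linarith [Nat.ceil_lt_add_one (show 0 ≤ m / r by positivity)]
  have hw1 := Nat.le_ceil (n / r ^ 2)
  have hw2 : (⌈n / r ^ 2⌉₊ : ℝ) ≤ 2 * (n / r ^ 2) := by
    linarith [Nat.ceil_lt_add_one (show 0 ≤ n / r ^ 2 by positivity)]
  have hq0 : 1 ≤ ⌈m / r⌉₊ := Nat.one_le_ceil_iff.2 (by positivity)
  have hw0 : 1 ≤ ⌈n / r ^ 2⌉₊ := Nat.one_le_ceil_iff.2 (by positivity)
  have key := hpar ⌈m / r⌉₊ ⌈n / r ^ 2⌉₊ hq0 hw0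
  have hqpos : (0 : ℝ) < ⌈m / r⌉₊ := by exact_mod_cast hq0
  have hwpos : (0 : ℝ) < ⌈n / r ^ 2⌉₊ := by exact_mod_cast hw0
  set q : ℝ := (⌈m / r⌉₊ : ℝ)
  set w : ℝ := (⌈n / r ^ 2⌉₊ : ℝ)
  have hmq : m / q ≤ r := by
    rw [div_le_iff₀ hqpos]
    rwa [div_le_iff₀ hr, mul_comm] at hq1
  have hnw : n / w ≤ r ^ 2 := by
    rw [div_le_iff₀ hwpos]
    rwa [div_le_iff₀ (by positivity), mul_comm] at hw1
  have hmq' : 0 ≤ m / q := by positivity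
  have hrr : r ≤ r ^ 2 := by nlinarith
  have a1 : m ^ 2 / q ≤ r * m := by
    have : m ^ 2 / q = m / q * m := by ring
    rw [this]; gcongr
  have a2 : 2 * n / w + (m / q + 2 + m ^ 2 / q ^ 2) ≤ 6 * r ^ 2 := by
    have e1 : 2 * n / w = 2 * (n / w) := by ring
    have e2 : m ^ 2 / q ^ 2 = (m / q) ^ 2 := by rw [div_pow]
    have e3 : (m / q) ^ 2 ≤ r ^ 2 := by gcongr
    rw [e1, e2]
    nlinarith
  have hexp : 1 / (t : ℝ) ≤ 1 := by rw [div_le_one (by linarith)]; exact ht'.le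
  have hexp0 : 0 ≤ 1 / (t : ℝ) := by positivity
  have a3 : w ^ (2 - 1 / (t : ℝ)) ≤ 4 * (m / r) := by
    calc w ^ (2 - 1 / (t : ℝ)) ≤ (2 * (n / r ^ 2)) ^ (2 - 1 / (t : ℝ)) :=
          Real.rpow_le_rpow hwpos.le hw2 (by linarith)
      _ = 2 ^ (2 - 1 / (t : ℝ)) * (m / r) := by
          rw [Real.mul_rpow (by norm_num) (by positivity), hbal]
      _ ≤ 2 ^ (2 : ℝ) * (m / r) := by
          gcongr
          · norm_num
          · linarith
      _ = 4 * (m / r) := by norm_num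
  have a4 : 2 * q + 4 * t * w ^ (2 - 1 / (t : ℝ)) ≤ 20 * t * (m / r) := by
    have b1 : 4 * t * w ^ (2 - 1 / (t : ℝ)) ≤ 4 * t * (4 * (m / r)) := by gcongr
    have b2 : m / r ≤ t * (m / r) := le_mul_of_one_le_left (by positivity) ht'.le
    linarith
  have a5 : (2 * n / w + (m / q + 2 + m ^ 2 / q ^ 2)) *
      (2 * q + 4 * t * w ^ (2 - 1 / (t : ℝ))) ≤ 6 * r ^ 2 * (20 * t * (m / r)) :=
    mul_le_mul a2 a4 (by positivity) (by positivity)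
  have a6 : 6 * r ^ 2 * (20 * t * (m / r)) = 120 * (t * (r * m)) := by
    field_simp
    ring
  have h2 : m ≤ t * m := le_mul_of_one_le_left hm.le ht'.le
  have h3 : r * m ≤ t * (r * m) := le_mul_of_one_le_left hrm.le ht'.le
  have h4 : 0 ≤ t * n := by positivity
  linarith

end Optimization

end PointLine

theorem theorem1 (t : ℕ) (ht : 1 < t) :
    ∃ c : ℝ, ∀ L₁ L₂ : Finset PointLine.Line, L₁.card = t → L₂.card = t →
      (PointLine.crossings (L₁ : Set PointLine.Line) (L₂ : Set PointLine.Line)).ncard = t ^ 2 →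
      ∀ (m n : ℕ) (P : Finset PointLine.Plane) (L : Finset PointLine.Line),
        P.card = m → L.card = n →
        ¬ PointLine.ContainsCopy (P : Set PointLine.Plane) (L : Set PointLine.Line)
            (PointLine.crossings (L₁ : Set PointLine.Line) (L₂ : Set PointLine.Line))
            ((L₁ : Set PointLine.Line) ∪ (L₂ : Set PointLine.Line)) →
        ((PointLine.incidences (P : Set PointLine.Plane) (L : Set PointLine.Line)).ncard : ℝ) ≤
          c * ((m : ℝ) ^ ((2 * (t : ℝ) - 2) / (3 * (t : ℝ) - 2)) *
                (n : ℝ) ^ ((2 * (t : ℝ) - 1) / (3 * (t : ℝ) - 2)) +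
              (m : ℝ) ^ (1 + 1 / (6 * (t : ℝ) - 3)) + (n : ℝ)) := by
  refine ⟨200 * t, fun L₁ L₂ h₁ h₂ h m n P L hm hn hcopy => ?_⟩
  subst hm hn
  have hfree := PointLine.gridFree_of_not_containsCopy ht L₁ L₂ h₁ h₂ h P L hcopy
  rw [PointLine.coe_incidences]
  refine (hfree.numInc_le_main ht).trans ?_
  have ht' : (1 : ℝ) < t := by exact_mod_cast ht
  -- The linear term `m` already proved is at most the required power of `m`; the case `m = 0` is
  -- separate since monotonicity in the exponent needs base at least 1.
  have hle : (P.card : ℝ) ≤ (P.card : ℝ) ^ (1 + 1 / (6 * (t : ℝ) - 3)) := by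
    have he : 0 ≤ 1 / (6 * (t : ℝ) - 3) := div_nonneg zero_le_one (by linarith)
    rcases Nat.eq_zero_or_pos P.card with h0 | h0
    · rw [h0]
      simpa using Real.rpow_nonneg le_rfl _
    · calc (P.card : ℝ) = (P.card : ℝ) ^ (1 : ℝ) := (Real.rpow_one _).symm
        _ ≤ _ := Real.rpow_le_rpow_of_exponent_le (by exact_mod_cast h0) (by linarith)
  gcongr
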